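/- All topological groups are assumed Hausdorff. A totally disconnected locally compact contraction group is a pair $(G,\alpha)$ consisting of a totally disconnected, locally compact group $G$ and an automorphism $\alpha$ of the topological group $G$ (so $\alpha$ and $\alpha^{-1}$ are continuous) such that $\lim_{n\to\infty}\alpha^n(x)=e$ for each $x\in G$. An isomorphism $(G,\alpha)\to(H,\beta)$ of such pairs is an isomorphism $\phi\colon G\to H$ of topological groups with $\phi\circ\alpha=\beta\circ\phi$. For a finite group $F$, let $F^{(-\mathbb N)}\times F^{\mathbb N_0}$ be the group of all sequences $(x_n)_{n\in\mathbb Z}$ in $F$ with $x_n=e$ for all but finitely many $n<0$, where the group $F^{(-\mathbb N)}$ of finitely supported sequences indexed by the negative integers is given the discrete topology, $F^{\mathbb N_0}$ the product topology (with $F$ discrete), and $F^{(-\mathbb N)}\times F^{\mathbb N_0}$ the product of these topologies; the right shift is the automorphism $(x_n)_{n\in\mathbb Z}\mapsto(x_{n-1})_{n\in\mathbb Z}$. **Theorem D.** Let $(G,\alpha)$ be a totally disconnected, locally compact contraction group such that $G$ is abelian and a torsion group. Then there is a finite abelian group $F$ such that $(G,\alpha)$ is isomorphic to $F^{(-\mathbb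 N)}\times F^{\mathbb N_0}$ with the right shift, and $F$ is determined by $(G,\alpha)$ up to isomorphism. Conversely, for every finite abelian group $F$, the group $F^{(-\mathbb N)}\times F^{\mathbb N_0}$ with the right shift, and hence every pair $(G,\alpha)$ isomorphic to it, is a totally disconnected, locally compact contraction group whose underlying group is an abelian torsion group. -/

import Mathlib

universe u v w

open Filter Topology

/-- `(G, α)` is a totally disconnected, locally compact contraction group: `G` is a totally
disconnected, locally compact Hausdorff topological group, and the (bicontinuous) automorphism
`α` of `G` is contractive, i.e. `α ^ n (x) → e` for each `x` in `G`. -/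
structure IsTDLCContractionGroup (G : Type u) [Group G] [TopologicalSpace G]
    (α : G ≃ₜ* G) : Prop where
  isTopologicalGroup : IsTopologicalGroup G
  t2Space : T2Space G
  locallyCompactSpace : LocallyCompactSpace G
  totallyDisconnectedSpace : TotallyDisconnectedSpace G
  contractive : ∀ x : G, Tendsto (fun n : ℕ => (⇑α)^[n] x) atTop (𝓝 1)

/-- `(G, α)` and `(H, β)` are isomorphic as contraction groups: there is an equivariant
isomorphism of topological groups. -/
def ContractionGroupIso {G : Type u} {H : Type v} [Group G] [TopologicalSpace G]
    [Group H] [TopologicalSpace H] (α : G ≃ₜ* G) (β : H ≃ₜ* H) : Prop :=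
  ∃ φ : G ≃ₜ* H, ∀ x : G, φ (α x) = β (φ x)

/-- The group `F^(-ℕ)` of finitely supported sequences indexed by `-1, -2, -3, …`; the
entry with index `-(k + 1)` is stored at `k : ℕ`. -/
def finSuppSeq (F : Type u) [Group F] : Subgroup (ℕ → F) where
  carrier := {x | (Function.mulSupport x).Finite}
  one_mem' := by simp
  mul_mem' {x y} hx hy := (Set.Finite.union hx hy).subset (Function.mulSupport_mul x y)
  inv_mem' {x} hx := by
    have h : (Function.mulSupport x).Finite := hx
    simpa [Function.mulSupport_inv] using h

/-- The group `F^(-ℕ) × F^(ℕ₀)`. -/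
def ShiftGroup (F : Type u) [Group F] : Type u := finSuppSeq F × (ℕ → F)

namespace ShiftGroup

variable {F : Type u} [Group F]

instance : Group (ShiftGroup F) := inferInstanceAs (Group (finSuppSeq F × (ℕ → F)))

/-- The discrete topology on `F^(-ℕ)`, times the product topology on `F^(ℕ₀)` with `F`
discrete. -/
instance : TopologicalSpace (ShiftGroup F) :=
  @instTopologicalSpaceProd (finSuppSeq F) (ℕ → F) ⊥
    (@Pi.topologicalSpace ℕ (fun _ => F) (fun _ => ⊥))

/-- The entry `x_n`, `n : ℤ`, of an element of `F^(-ℕ) × F^(ℕ₀)` regarded as a two-sided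
sequence. -/
def entry (x : ShiftGroup F) : ℤ → F
  | Int.ofNat n => x.2 n
  | Int.negSucc k => x.1.1 k

/-- The right shift on underlying sets. -/
def shiftFun (x : ShiftGroup F) : ShiftGroup F :=
  (⟨fun k => x.1.1 (k + 1), x.1.2.preimage (Nat.succ_injective.injOn)⟩,
    fun n => Nat.casesOn n (x.1.1 0) (fun m => x.2 m))

/-- The left shift on underlying sets, inverse to the right shift. -/
def unshiftFun (x : ShiftGroup F) : ShiftGroup F :=
  (⟨fun k => Nat.casesOn k (x.2 0) (fun m => x.1.1 m), by
      refine ((x.1.2.image Nat.succ).insert 0).subset ?_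
      rintro (_ | k) hk
      · exact Set.mem_insert _ _
      · exact Set.mem_insert_of_mem _ ⟨k, hk, rfl⟩⟩,
    fun n => x.2 (n + 1))

theorem continuous_shiftFun : Continuous (shiftFun : ShiftGroup F → ShiftGroup F) := by
  let _ : TopologicalSpace F := ⊥
  let _ : TopologicalSpace (finSuppSeq F) := ⊥
  have : DiscreteTopology F := ⟨rfl⟩
  have : DiscreteTopology (finSuppSeq F) := ⟨rfl⟩
  have h : Continuous (fun x : finSuppSeq F × (ℕ → F) =>
      (shiftFun (F := F) x : finSuppSeq F × (ℕ → F))) := by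
    refine Continuous.prodMk ?_ (continuous_pi ?_)
    · exact (continuous_of_discreteTopology (f := fun y : finSuppSeq F =>
        (shiftFun (F := F) (y, 1)).1)).comp continuous_fst
    · rintro (_ | n)
      · exact (continuous_of_discreteTopology (f := fun y : finSuppSeq F => y.1 0)).comp
          continuous_fst
      · exact (continuous_apply n).comp continuous_snd
  exact h

theorem continuous_unshiftFun : Continuous (unshiftFun : ShiftGroup F → ShiftGroup F) := by
  let _ : TopologicalSpace F := ⊥
  let _ : TopologicalSpace (finSuppSeq F) := ⊥
  have : DiscreteTopology F := ⟨rfl⟩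
  have : DiscreteTopology (finSuppSeq F) := ⟨rfl⟩
  have h : Continuous (fun x : finSuppSeq F × (ℕ → F) =>
      (unshiftFun (F := F) x : finSuppSeq F × (ℕ → F))) := by
    refine Continuous.prodMk ?_ (continuous_pi ?_)
    · exact (continuous_of_discreteTopology (f := fun y : finSuppSeq F × F =>
        (unshiftFun (F := F) (y.1, fun _ => y.2)).1)).comp
        (continuous_fst.prodMk ((continuous_apply 0).comp continuous_snd))
    · intro n
      exact (continuous_apply (n + 1)).comp continuous_snd
  exact h

/-- The right shift `(x_n)_n ↦ (x_(n-1))_n` as an automorphism of the topological group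
`F^(-ℕ) × F^(ℕ₀)`. -/
def shift (F : Type u) [Group F] : ShiftGroup F ≃ₜ* ShiftGroup F where
  toFun := shiftFun
  invFun := unshiftFun
  left_inv x := by
    refine Prod.ext (Subtype.ext (funext ?_)) rfl
    rintro (_ | k) <;> rfl
  right_inv x := by
    refine Prod.ext rfl (funext ?_)
    rintro (_ | k) <;> rfl
  map_mul' x y := by
    refine Prod.ext rfl (funext ?_)
    rintro (_ | k) <;> rfl
  continuous_toFun := continuous_shiftFun
  continuous_invFun := continuous_unshiftFun

theorem entry_shift (x : ShiftGroup F) (n : ℤ) : (shift F x).entry n = x.entry (n - 1) := by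
  rcases n with (_ | n) | k
  · rfl
  · have : (Int.ofNat (n + 1) - 1 : ℤ) = Int.ofNat n := by simp
    rw [this]; rfl
  · rfl

end ShiftGroup

/-! Write an abelian contraction group additively as `M`. A compact open subgroup `V` with `a V ⊆ V`
makes Laurent series in the contraction `a` converge, so `M` becomes a module over `ℤ⸨X⸩` on which
`X` acts as `a`; it is finitely generated because `V / a V` is finite. The ring `ℤ⸨X⸩` is a
principal ideal domain whose divisors of nonzero integers are, up to units, integers. Hence a
torsion `M` is a direct sum of modules `ℤ⸨X⸩ ⧸ (q)` with `q` a nonzero integer, and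
`ℤ⸨X⸩ ⧸ (q) = (ℤ/q)⸨X⸩` is the shift group of `ℤ/q`.

For uniqueness, an equivariant isomorphism between the shift groups of `F` and `F'` displaces
supports by a bounded amount. For a finite monoid `A`, comparing homomorphisms from `A` to the
sequences supported in `[0, N)` gives `|Hom(A, F)| ^ N ≤ |Hom(A, F')| ^ (N + e)` for all `N`, so
`F` and `F'` receive equally many homomorphisms from every finite monoid; by Lovász they are
isomorphic.
-/

theorem le_of_forall_pow_le_pow_add {s t e : ℕ} (ht : 0 < t) (h : ∀ N, s ^ N ≤ t ^ (N + e)) :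
    s ≤ t := by
  by_contra! hlt
  have ht' : (0 : ℝ) < t := by exact_mod_cast ht
  obtain ⟨N, hN⟩ := pow_unbounded_of_one_lt ((t : ℝ) ^ e)
    (show (1 : ℝ) < (s : ℝ) / t by rw [one_lt_div ht']; exact_mod_cast hlt)
  rw [div_pow, lt_div_iff₀ (by positivity), ← pow_add, add_comm] at hN
  exact absurd (h N) (not_le.mpr (by exact_mod_cast hN))

section HomCount

open Function (Injective)

variable {A : Type u} {F : Type v} {F' : Type w} [Monoid A] [Monoid F] [Monoid F']

theorem finite_monoidHom (A : Type u) (F : Type v) [Monoid A] [Monoid F] [Finite A] [Finite F] :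
    Finite (A →* F) :=
  DFunLike.finite _

theorem finite_con (A : Type u) [Monoid A] [Finite A] : Finite (Con A) :=
  .of_injective (fun c : Con A => (⇑c : A → A → Prop)) DFunLike.coe_injective

theorem card_injective_monoidHom_congr {B : Type w} [Monoid B] (e : A ≃* B) (F : Type v)
    [Monoid F] :
    Nat.card {g : A →* F // Injective g} = Nat.card {g : B →* F // Injective g} :=
  Nat.card_congr (e.monoidHomCongrLeftEquiv.subtypeEquiv fun g =>
    (Function.Injective.of_comp_iff' g e.symm.bijective).symm)

/-- The homomorphisms `A →* F` correspond to pairs of a congruence on `A` (the kernel) and an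
injective homomorphism out of the quotient. -/
noncomputable def sigmaConEquivMonoidHom (A : Type u) (F : Type v) [Monoid A] [Monoid F] :
    (Σ c : Con A, {g : c.Quotient →* F // Injective g}) ≃ (A →* F) :=
  .ofBijective (fun p => p.2.1.comp p.1.mk') <| by
    refine ⟨?_, fun f => ⟨⟨Con.ker f, Con.kerLift f, Con.kerLift_injective f⟩, rfl⟩⟩
    rintro ⟨c, g, hg⟩ ⟨c', g', hg'⟩ (h : g.comp c.mk' = g'.comp c'.mk')
    have ker_comp_mk' (c : Con A) (g : c.Quotient →* F) (hg : Injective g) :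
        Con.ker (g.comp c.mk') = c :=
      Con.ext fun x y => (hg.eq_iff (a := (x : c.Quotient)) (b := y)).trans (c.eq)
    obtain rfl : c = c' := by rw [← ker_comp_mk' c g hg, h, ker_comp_mk' c' g' hg']
    obtain rfl : g = g' := Con.hom_ext h
    rfl

theorem card_monoidHom_eq_sum [Finite A] [Finite F] [Fintype (Con A)] :
    Nat.card (A →* F) = ∑ c : Con A, Nat.card {g : c.Quotient →* F // Injective g} := by
  have (c : Con A) : Finite c.Quotient := Quotient.finite _
  have (c : Con A) := finite_monoidHom c.Quotient F
  rw [← Nat.card_sigma, Nat.card_congr (sigmaConEquivMonoidHom A F)]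

theorem card_quotient_lt_of_ne_bot [Finite A] {c : Con A} (hc : c ≠ ⊥) :
    Nat.card c.Quotient < Nat.card A := by
  refine (Nat.card_le_card_of_surjective _ c.mk'_surjective).lt_of_ne fun h => hc ?_
  have hinj : Injective c.mk' :=
    ((Nat.bijective_iff_surjective_and_card _).mpr ⟨c.mk'_surjective, h.symm⟩).1
  refine eq_bot_iff.mpr fun x y hxy => hinj (c.eq.mpr hxy)

/-- Lovász's argument: sort the homomorphisms `A →* F` by their kernels; by induction, all summands
but the one with trivial kernel agree for `F` and `F'`, hence so does that one. -/
theorem card_injective_monoidHom_eq [Finite F] [Finite F']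
    (h : ∀ (A : Type u) [Monoid A] [Finite A], Nat.card (A →* F) = Nat.card (A →* F'))
    (A : Type u) [Monoid A] [Finite A] :
    Nat.card {g : A →* F // Injective g} = Nat.card {g : A →* F' // Injective g} := by
  induction hn : Nat.card A using Nat.strong_induction_on generalizing A with
  | _ n ih =>
    classical
    have := finite_con A
    have : Fintype (Con A) := Fintype.ofFinite _
    have quotientBot : A ≃* (⊥ : Con A).Quotient :=
      .ofBijective (⊥ : Con A).mk' ⟨fun x y hxy => (⊥ : Con A).eq.mp hxy, Con.mk'_surjective⟩
    have proper_eq : ∀ c ∈ Finset.univ.erase (⊥ : Con A),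
        Nat.card {g : c.Quotient →* F // Injective g} =
          Nat.card {g : c.Quotient →* F' // Injective g} := fun c hc =>
      have : Finite c.Quotient := Quotient.finite _
      ih _ (hn ▸ card_quotient_lt_of_ne_bot (Finset.ne_of_mem_erase hc)) _ rfl
    have total_eq := h A
    rw [card_monoidHom_eq_sum, card_monoidHom_eq_sum,
      ← Finset.add_sum_erase _ _ (Finset.mem_univ (⊥ : Con A)),
      ← Finset.add_sum_erase _ _ (Finset.mem_univ (⊥ : Con A)),
      Finset.sum_congr rfl proper_eq, Nat.add_right_cancel_iff] at total_eq
    rw [card_injective_monoidHom_congr quotientBot F, total_eq,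
      card_injective_monoidHom_congr quotientBot F']

theorem exists_injective_monoidHom_of_card_eq [Finite F]
    (h : Nat.card {g : F →* F // Injective g} = Nat.card {g : F →* F' // Injective g}) :
    ∃ g : F →* F', Injective g := by
  have := finite_monoidHom F F
  have : Nonempty {g : F →* F // Injective g} := ⟨MonoidHom.id F, Function.injective_id⟩
  obtain ⟨⟨g, hg⟩⟩ := (Nat.card_pos_iff.mp (h ▸ Nat.card_pos)).1
  exact ⟨g, hg⟩

theorem nonempty_mulEquiv_of_card_monoidHom_eq [Finite F] [Finite F']
    (h : ∀ (A : Type v) [Monoid A] [Finite A], Nat.card (A →* F) = Nat.card (A →* F'))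
    (h' : ∀ (A : Type w) [Monoid A] [Finite A], Nat.card (A →* F) = Nat.card (A →* F')) :
    Nonempty (F ≃* F') := by
  obtain ⟨g, hg⟩ := exists_injective_monoidHom_of_card_eq (card_injective_monoidHom_eq h F)
  obtain ⟨g', hg'⟩ := exists_injective_monoidHom_of_card_eq (card_injective_monoidHom_eq h' F').symm
  have hcard : Nat.card F = Nat.card F' :=
    le_antisymm (Nat.card_le_card_of_injective g hg) (Nat.card_le_card_of_injective g' hg')
  exact ⟨.ofBijective g ((Nat.bijective_iff_injective_and_card g).mpr ⟨hg, hcard⟩)⟩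

end HomCount

namespace ContractionGroupIso

variable {G : Type u} {H : Type v} {K : Type w} [Group G] [TopologicalSpace G] [Group H]
  [TopologicalSpace H] [Group K] [TopologicalSpace K] {α : G ≃ₜ* G} {β : H ≃ₜ* H} {γ : K ≃ₜ* K}

theorem symm (h : ContractionGroupIso α β) : ContractionGroupIso β α := by
  obtain ⟨φ, hφ⟩ := h
  exact ⟨φ.symm, fun y => by rw [φ.symm_apply_eq, hφ, φ.apply_symm_apply]⟩

theorem trans (h : ContractionGroupIso α β) (h' : ContractionGroupIso β γ) :
    ContractionGroupIso α γ := by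
  obtain ⟨φ, hφ⟩ := h
  obtain ⟨ψ, hψ⟩ := h'
  exact ⟨φ.trans ψ, fun x => (congrArg ψ (hφ x)).trans (hψ (φ x))⟩

theorem mul_comm_of_mul_comm (h : ContractionGroupIso α β) (hH : ∀ x y : H, x * y = y * x)
    (x y : G) : x * y = y * x := by
  obtain ⟨φ, -⟩ := h
  exact φ.injective (by rw [map_mul, map_mul, hH])

theorem isMulTorsion (h : ContractionGroupIso α β) (hH : IsMulTorsion H) : IsMulTorsion G := by
  obtain ⟨φ, -⟩ := h
  exact .of_surjective (f := φ.symm.toMonoidHom) φ.symm.surjective hH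

theorem isTDLCContractionGroup (h : ContractionGroupIso α β)
    (hβ : IsTDLCContractionGroup H β) : IsTDLCContractionGroup G α := by
  obtain ⟨φ, hφ⟩ := h
  obtain ⟨_, _, _, _, hcontr⟩ := hβ
  refine ⟨φ.toHomeomorph.isInducing.topologicalGroup φ.toMulEquiv,
    φ.toHomeomorph.symm.t2Space, φ.toHomeomorph.isClosedEmbedding.locallyCompactSpace,
    φ.toHomeomorph.symm.totallyDisconnectedSpace, fun x => ?_⟩
  have iterate_eq (n : ℕ) : φ.symm ((⇑β)^[n] (φ x)) = (⇑α)^[n] x := by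
    rw [φ.symm_apply_eq, ← (Function.Semiconj.iterate_right (f := φ) hφ n) x]
  exact ((φ.symm.continuous.tendsto' 1 1 (map_one φ.symm)).comp (hcontr (φ x))).congr iterate_eq

end ContractionGroupIso

namespace ShiftGroup

section Entries

variable {F : Type u} [Group F]

theorem ext_entry {x y : ShiftGroup F} (h : ∀ n, x.entry n = y.entry n) : x = y :=
  Prod.ext (Subtype.ext (funext fun k => h (Int.negSucc k))) (funext fun n => h (Int.ofNat n))

/-- The `n`-th entry, as a homomorphism. -/
def entryHom (F : Type u) [Group F] (n : ℤ) : ShiftGroup F →* F where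
  toFun x := x.entry n
  map_one' := by cases n <;> rfl
  map_mul' x y := by cases n <;> rfl

theorem entry_one (n : ℤ) : (1 : ShiftGroup F).entry n = 1 := map_one (entryHom F n)

theorem entry_mul (x y : ShiftGroup F) (n : ℤ) : (x * y).entry n = x.entry n * y.entry n :=
  map_mul (entryHom F n) x y

theorem entry_div (x y : ShiftGroup F) (n : ℤ) : (x / y).entry n = x.entry n / y.entry n :=
  map_div (entryHom F n) x y

theorem entry_pow (x : ShiftGroup F) (k : ℕ) (n : ℤ) : (x ^ k).entry n = x.entry n ^ k :=
  map_pow (entryHom F n) x k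

/-- The element with prescribed entries, almost all of which are trivial at negative indices. -/
def ofEntries (f : ℤ → F) (hf : ∃ N : ℤ, ∀ n < N, f n = 1) : ShiftGroup F :=
  (⟨fun k => f (Int.negSucc k), by
    obtain ⟨N, hN⟩ := hf
    refine (Set.finite_Iic (-N).toNat).subset fun k hk => ?_
    contrapose! hk
    have : Int.negSucc k < N := by simp only [Set.mem_Iic] at hk; omega
    simp [hN _ this]⟩, fun n => f (Int.ofNat n))

theorem entry_ofEntries (f : ℤ → F) (hf : ∃ N : ℤ, ∀ n < N, f n = 1) (n : ℤ) :
    (ofEntries f hf).entry n = f n := by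
  cases n <;> rfl

/-- The subgroup of the sequences supported in `[N, ∞)`. These subgroups form the standard
neighbourhood basis of the identity. -/
def tail (F : Type u) [Group F] (N : ℤ) : Subgroup (ShiftGroup F) :=
  ⨅ n : Set.Iio N, (entryHom F n).ker

theorem mem_tail {N : ℤ} {x : ShiftGroup F} : x ∈ tail F N ↔ ∀ n < N, x.entry n = 1 := by
  simp [tail, Subgroup.mem_iInf, MonoidHom.mem_ker, entryHom]

theorem exists_mem_tail (x : ShiftGroup F) : ∃ N : ℤ, x ∈ tail F N := by
  obtain ⟨K, hK⟩ := x.1.2.bddAbove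
  refine ⟨-(K + 1 : ℤ), mem_tail.mpr ?_⟩
  rintro (n | k) hn
  · have : (0 : ℤ) ≤ Int.ofNat n := Int.natCast_nonneg n
    omega
  · by_contra hk
    have := hK (show k ∈ Function.mulSupport x.1.1 from hk)
    omega

theorem entry_iterate_shift (k : ℕ) (x : ShiftGroup F) (n : ℤ) :
    ((shift F)^[k] x).entry n = x.entry (n - k) := by
  induction k generalizing n with
  | zero => simp
  | succ k ih => rw [Function.iterate_succ_apply', entry_shift, ih]; congr 1; push_cast; ring

/-- The right shift as an element of the automorphism group, so that it has integral powers. -/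
def shiftAut (F : Type u) [Group F] : MulAut (ShiftGroup F) := (shift F).toMulEquiv

theorem entry_shiftAut_zpow (k : ℤ) (x : ShiftGroup F) (n : ℤ) :
    ((shiftAut F ^ k) x).entry n = x.entry (n - k) := by
  have entry_shiftAut (x : ShiftGroup F) (n : ℤ) : (shiftAut F x).entry n = x.entry (n - 1) :=
    entry_shift x n
  induction k generalizing x n with
  | zero => simp
  | succ k ih => rw [zpow_add_one, MulAut.mul_apply, ih, entry_shiftAut, sub_sub]
  | pred k ih =>
    rw [zpow_sub_one, MulAut.mul_apply, ih]
    conv_rhs => rw [← MulAut.apply_inv_self _ (shiftAut F) x, entry_shiftAut]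
    congr 1; ring

theorem shiftAut_zpow_mem_tail {k N : ℤ} {x : ShiftGroup F} :
    (shiftAut F ^ k) x ∈ tail F N ↔ x ∈ tail F (N - k) := by
  simp only [mem_tail, entry_shiftAut_zpow]
  exact ⟨fun h n hn => by simpa using h (n + k) (by omega), fun h n hn => h _ (by omega)⟩

theorem mul_comm_of_mul_comm (hF : ∀ a b : F, a * b = b * a) (x y : ShiftGroup F) :
    x * y = y * x :=
  ext_entry fun n => by rw [entry_mul, entry_mul, hF]

theorem isMulTorsion [Finite F] : IsMulTorsion (ShiftGroup F) := fun x =>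
  isOfFinOrder_iff_pow_eq_one.mpr ⟨Nat.card F, Nat.card_pos, ext_entry fun n => by
    rw [entry_pow, pow_card_eq_one', entry_one]⟩

end Entries

section Topology

/-- A copy of `X` with the discrete topology, in terms of which the topology of the shift group is
a product topology found by instance search. -/
def DiscreteCopy (X : Type u) : Type u := X

instance (X : Type u) : TopologicalSpace (DiscreteCopy X) := ⊥
instance (X : Type u) : DiscreteTopology (DiscreteCopy X) := ⟨rfl⟩
instance (X : Type u) [Group X] : Group (DiscreteCopy X) := inferInstanceAs (Group X)
instance (X : Type u) [Finite X] : Finite (DiscreteCopy X) := inferInstanceAs (Finite X)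
instance (X : Type u) [Countable X] : Countable (DiscreteCopy X) := inferInstanceAs (Countable X)

variable {F : Type u} [Group F]

instance : IsTopologicalGroup (ShiftGroup F) :=
  inferInstanceAs (IsTopologicalGroup (DiscreteCopy (finSuppSeq F) × (ℕ → DiscreteCopy F)))

instance : T2Space (ShiftGroup F) :=
  inferInstanceAs (T2Space (DiscreteCopy (finSuppSeq F) × (ℕ → DiscreteCopy F)))

instance : TotallyDisconnectedSpace (ShiftGroup F) :=
  inferInstanceAs (TotallyDisconnectedSpace (DiscreteCopy (finSuppSeq F) × (ℕ → DiscreteCopy F)))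

instance [Finite F] : LocallyCompactSpace (ShiftGroup F) :=
  inferInstanceAs (LocallyCompactSpace (DiscreteCopy (finSuppSeq F) × (ℕ → DiscreteCopy F)))

instance [Finite F] : Countable (finSuppSeq F) :=
  Function.Injective.countable
    (f := fun x : finSuppSeq F => Finsupp.ofSupportFinite (fun n => Additive.ofMul (x.1 n)) x.2)
    fun _ _ h => Subtype.ext (funext (DFunLike.congr_fun h))

instance [Finite F] : SigmaCompactSpace (ShiftGroup F) :=
  inferInstanceAs (SigmaCompactSpace (DiscreteCopy (finSuppSeq F) × (ℕ → DiscreteCopy F)))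

theorem tail_mem_nhds_one (N : ℤ) : (tail F N : Set (ShiftGroup F)) ∈ 𝓝 1 := by
  have prod_mem_nhds : ({1} : Set (DiscreteCopy (finSuppSeq F))) ×ˢ
      ((Finset.range N.toNat : Set ℕ).pi fun _ => ({1} : Set (DiscreteCopy F))) ∈ 𝓝 1 :=
    prod_mem_nhds (by simp) (set_pi_mem_nhds (Finset.finite_toSet _) fun n _ => by simp)
  refine mem_of_superset prod_mem_nhds ?_
  rintro ⟨x, y⟩ ⟨hx, hy⟩
  obtain rfl : x = 1 := hx
  refine mem_tail.mpr ?_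
  rintro (n | k) hn
  · exact hy n (by simpa using hn)
  · rfl

theorem exists_tail_subset {U : Set (ShiftGroup F)} (hU : U ∈ 𝓝 1) :
    ∃ N : ℤ, (tail F N : Set (ShiftGroup F)) ⊆ U := by
  obtain ⟨s, hs, t, ht, hst⟩ := mem_nhds_prod_iff.mp
    (show U ∈ 𝓝 ((1, 1) : DiscreteCopy (finSuppSeq F) × (ℕ → DiscreteCopy F)) from hU)
  obtain ⟨t', ht', hto, h1⟩ := mem_nhds_iff.mp ht
  obtain ⟨I, u, hu, hI⟩ := isOpen_pi_iff.mp hto 1 h1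
  obtain ⟨K, hK⟩ := I.bddAbove
  refine ⟨K + 1, fun x hx => hst ⟨?_, ht' (hI fun n hn => ?_)⟩⟩ <;>
    rw [SetLike.mem_coe, mem_tail] at hx
  · have : x.1 = 1 := Subtype.ext (funext fun k => hx (Int.negSucc k) (by omega))
    exact this ▸ mem_of_mem_nhds hs
  · have : x.2 n = 1 := hx (Int.ofNat n) (by
      have := hK hn
      simp only [Int.ofNat_eq_natCast]
      omega)
    exact this ▸ (hu n hn).2

theorem tendsto_iterate_shift (x : ShiftGroup F) :
    Tendsto (fun k : ℕ => (shift F)^[k] x) atTop (𝓝 1) := by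
  intro U hU
  obtain ⟨N, hN⟩ := exists_tail_subset hU
  obtain ⟨K, hK⟩ := exists_mem_tail x
  refine mem_atTop_sets.mpr ⟨(N - K).toNat, fun k hk => hN (mem_tail.mpr fun n hn => ?_)⟩
  rw [entry_iterate_shift]
  exact mem_tail.mp hK _ (by omega)

theorem isTDLCContractionGroup [Finite F] : IsTDLCContractionGroup (ShiftGroup F) (shift F) :=
  ⟨inferInstance, inferInstance, inferInstance, inferInstance, tendsto_iterate_shift⟩

end Topology

section Uniqueness

variable {F : Type v} {F' : Type w} [Group F] [Group F']

/-- Equivariance turns continuity at the identity into a bound on the displacement of supports that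
is uniform in `N`. -/
theorem exists_map_mem_tail (φ : ShiftGroup F ≃ₜ* ShiftGroup F')
    (hφ : ∀ x, φ (shift F x) = shift F' (φ x)) :
    ∃ c : ℕ, ∀ (N : ℤ), ∀ x ∈ tail F N, φ x ∈ tail F' (N - c) := by
  have map_zpow_apply (k : ℤ) (x : ShiftGroup F) :
      φ ((shiftAut F ^ k) x) = (shiftAut F' ^ k) (φ x) := by
    have hconj : MulAut.congr φ.toMulEquiv (shiftAut F) = shiftAut F' :=
      MulEquiv.ext fun y => (hφ (φ.symm y)).trans (congrArg (shift F') (φ.apply_symm_apply y))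
    rw [← hconj, ← map_zpow]
    exact congrArg (fun z => φ ((shiftAut F ^ k) z)) (φ.symm_apply_apply x).symm
  obtain ⟨K, hK⟩ := exists_tail_subset (F := F) (U := φ ⁻¹' tail F' 0)
    (φ.continuous.tendsto' 1 1 (map_one φ) (tail_mem_nhds_one 0))
  refine ⟨K.toNat, fun N x hx => ?_⟩
  have hmem : φ ((shiftAut F ^ (K - N)) x) ∈ tail F' 0 :=
    hK (shiftAut_zpow_mem_tail.mpr (by simpa using hx))
  rw [map_zpow_apply, shiftAut_zpow_mem_tail, mem_tail] at hmem
  exact mem_tail.mpr fun n hn => hmem n (by omega)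

/-- A sequence `f 0, …, f (N - 1)` of homomorphisms to `F`, as a homomorphism to the sequences
supported in `[0, N)`. -/
noncomputable def homOfFin {A : Type*} [Monoid A] {N : ℕ} (f : Fin N → (A →* F)) :
    A →* ShiftGroup F :=
  (MonoidHom.inr (finSuppSeq F) (ℕ → F)).comp (MonoidHom.pi (Function.extend Fin.val f 1))

theorem homOfFin_mem_tail {A : Type*} [Monoid A] {N : ℕ} (f : Fin N → (A →* F)) (a : A) :
    homOfFin f a ∈ tail F 0 :=
  mem_tail.mpr fun n hn => by
    obtain ⟨k, rfl⟩ := Int.eq_negSucc_of_lt_zero hn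
    rfl

theorem entry_homOfFin {A : Type*} [Monoid A] {N : ℕ} (f : Fin N → (A →* F)) (a : A)
    (i : Fin N) : (homOfFin f a).entry (i : ℕ) = f i a :=
  DFunLike.congr_fun (Fin.val_injective.extend_apply f 1 i) a

/-- If `φ` moves supports by at most `c` and `φ⁻¹` by at most `d`, then a sequence `x` supported in
`[0, N)` is determined by the entries of `φ x` in `[-c, N + d)`. -/
theorem card_monoidHom_le_of_iso [Finite F']
    (h : ContractionGroupIso (shift F) (shift F')) (A : Type*) [Monoid A] [Finite A] :
    Nat.card (A →* F) ≤ Nat.card (A →* F') := by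
  obtain ⟨φ, hφ⟩ := h
  obtain ⟨c, hc⟩ := exists_map_mem_tail φ hφ
  obtain ⟨d, hd⟩ := exists_map_mem_tail φ.symm fun y => by
    rw [φ.symm_apply_eq, hφ, φ.apply_symm_apply]
  have := finite_monoidHom A F'
  refine le_of_forall_pow_le_pow_add (e := c + d) Nat.card_pos fun N => ?_
  let window (f : Fin N → (A →* F)) (i : Fin (N + (c + d))) : A →* F' :=
    (entryHom F' (i - c : ℤ)).comp (φ.toMonoidHom.comp (homOfFin f))
  suffices Function.Injective window by
    simpa [Nat.card_fun] using Nat.card_le_card_of_injective window this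
  intro f g hfg
  ext i a
  have hquot : homOfFin f a / homOfFin g a ∈ tail F N := by
    rw [← φ.symm_apply_apply (_ / _)]
    suffices φ (homOfFin f a / homOfFin g a) ∈ tail F' (N + d) by simpa using hd _ _ this
    refine mem_tail.mpr fun n hn => ?_
    rcases lt_or_ge n (0 - c) with hlt | hge
    · exact mem_tail.mp (hc 0 _ (div_mem (homOfFin_mem_tail f a) (homOfFin_mem_tail g a))) n hlt
    · have hentry := DFunLike.congr_fun (congrFun hfg ⟨(n + c).toNat, by omega⟩) a
      have hindex : (((n + c).toNat : ℕ) : ℤ) - c = n := by omega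
      simp only [window, hindex] at hentry
      rw [map_div, entry_div]
      exact div_eq_one.mpr hentry
  have hi := mem_tail.mp hquot i (by omega)
  rwa [entry_div, entry_homOfFin, entry_homOfFin, div_eq_one] at hi

theorem card_monoidHom_eq_of_iso [Finite F] [Finite F']
    (h : ContractionGroupIso (shift F) (shift F')) (A : Type*) [Monoid A] [Finite A] :
    Nat.card (A →* F) = Nat.card (A →* F') :=
  le_antisymm (card_monoidHom_le_of_iso h A) (card_monoidHom_le_of_iso h.symm A)

theorem nonempty_mulEquiv_of_iso [Finite F] [Finite F']
    (h : ContractionGroupIso (shift F) (shift F')) : Nonempty (F ≃* F') :=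
  nonempty_mulEquiv_of_card_monoidHom_eq (card_monoidHom_eq_of_iso h) (card_monoidHom_eq_of_iso h)

end Uniqueness

end ShiftGroup

section VanDantzig

open Pointwise

variable {G : Type u} [Group G] [TopologicalSpace G] [IsTopologicalGroup G]

theorem exists_isOpen_isCompact_subgroup [T2Space G] [LocallyCompactSpace G]
    [TotallyDisconnectedSpace G] {U : Set G} (hU : U ∈ 𝓝 1) :
    ∃ K : Subgroup G, IsOpen (K : Set G) ∧ IsCompact (K : Set G) ∧ (K : Set G) ⊆ U := by
  obtain ⟨N, hN, hNU, hNc⟩ := local_compact_nhds hU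
  obtain ⟨C, hC, h1, hCN⟩ := (loc_compact_Haus_tot_disc_of_zero_dim (H := G)).mem_nhds_iff.mp hN
  have hCc : IsCompact C := hNc.of_isClosed_subset hC.isClosed hCN
  obtain ⟨T, hT, hTC⟩ := compact_open_separated_mul_left hCc hC.isOpen subset_rfl
  have smul_subset {g : G} (hg : g ∈ T) : g • C ⊆ C := (Set.smul_set_subset_smul hg).trans hTC
  let K : Subgroup G := MulAction.stabilizer G C
  have hKC : (K : Set G) ⊆ C := fun g hg => by
    have : g • (1 : G) ∈ g • C := Set.smul_mem_smul_set h1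
    rwa [MulAction.mem_stabilizer_iff.mp hg, smul_eq_mul, mul_one] at this
  have hKo : IsOpen (K : Set G) := by
    refine K.isOpen_of_mem_nhds (g := 1) ?_
    filter_upwards [hT, inv_mem_nhds_one G hT] with g hg hg'
    exact (smul_subset hg).antisymm (Set.subset_smul_set_iff.mpr (smul_subset hg'))
  exact ⟨K, hKo, hCc.of_isClosed_subset (K.isClosed_of_isOpen hKo) hKC, (hKC.trans hCN).trans hNU⟩

end VanDantzig

section StableCore

variable {G : Type u} [Group G]

/-- The largest subgroup of `K` which is stable under the endomorphism `f`. -/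
def stableCore (f : G →* G) (K : Subgroup G) : Subgroup G where
  carrier := {x | ∀ k : ℕ, f^[k] x ∈ K}
  one_mem' k := by simp [iterate_map_one]
  mul_mem' hx hy k := by simpa [iterate_map_mul] using mul_mem (hx k) (hy k)
  inv_mem' hx k := by simpa [iterate_map_inv] using hx k

variable {f : G →* G} {K : Subgroup G}

theorem mem_stableCore {x : G} : x ∈ stableCore f K ↔ ∀ k : ℕ, f^[k] x ∈ K := Iff.rfl

theorem stableCore_le : stableCore f K ≤ K := fun _ hx => hx 0

theorem map_mem_stableCore {x : G} (hx : x ∈ stableCore f K) : f x ∈ stableCore f K :=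
  fun k => hx (k + 1)

variable [TopologicalSpace G]

theorem isClosed_stableCore (hf : Continuous f) (hK : IsClosed (K : Set G)) :
    IsClosed (stableCore f K : Set G) := by
  have : (stableCore f K : Set G) = ⋂ k : ℕ, f^[k] ⁻¹' K := by
    ext x
    simp [mem_stableCore]
  exact this ▸ isClosed_iInter fun k => hK.preimage (hf.iterate k)

theorem isOpen_stableCore [ContinuousMul G] [BaireSpace G] (hf : Continuous f)
    (hf' : IsOpenMap f) (hK : IsClosed (K : Set G))
    (hev : ∀ x, ∀ᶠ n : ℕ in atTop, f^[n] x ∈ K) : IsOpen (stableCore f K : Set G) := by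
  have covers : ⋃ n : ℕ, f^[n] ⁻¹' stableCore f K = Set.univ :=
    Set.eq_univ_of_forall fun x => by
      obtain ⟨n, hn⟩ := eventually_atTop.mp (hev x)
      refine Set.mem_iUnion.mpr ⟨n, fun k => ?_⟩
      rw [← Function.iterate_add_apply]
      exact hn _ (Nat.le_add_left n k)
  obtain ⟨n, x, hx⟩ := nonempty_interior_of_iUnion_of_closed
    (fun n => (isClosed_stableCore hf hK).preimage (hf.iterate n)) covers
  refine Subgroup.isOpen_of_mem_nhds _ (g := f^[n] x) ?_
  have isOpenMap_iterate (m : ℕ) : IsOpenMap f^[m] := by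
    induction m with
    | zero => exact IsOpenMap.id
    | succ m ih => exact ih.comp hf'
  refine mem_of_superset ((isOpenMap_iterate n _ isOpen_interior).mem_nhds ⟨x, hx, rfl⟩) ?_
  exact Set.image_subset_iff.mpr interior_subset

end StableCore

namespace IsTDLCContractionGroup

variable {G : Type u} [Group G] [TopologicalSpace G] {α : G ≃ₜ* G}

theorem eventually_iterate_mem (h : IsTDLCContractionGroup G α) {U : Set G} (hU : U ∈ 𝓝 1)
    (x : G) : ∀ᶠ n : ℕ in atTop, α^[n] x ∈ U :=
  h.contractive x hU

theorem exists_isOpen_isCompact_map_mem (h : IsTDLCContractionGroup G α) {U : Set G}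
    (hU : U ∈ 𝓝 1) :
    ∃ V : Subgroup G, IsOpen (V : Set G) ∧ IsCompact (V : Set G) ∧ (V : Set G) ⊆ U ∧
      ∀ x ∈ V, α x ∈ V := by
  have ⟨_, _, _, _, _⟩ := h
  obtain ⟨K, hKo, hKc, hKU⟩ := exists_isOpen_isCompact_subgroup hU
  have hKcl := K.isClosed_of_isOpen hKo
  have hcl := isClosed_stableCore (f := α.toMonoidHom) α.continuous hKcl
  exact ⟨stableCore α.toMonoidHom K,
    isOpen_stableCore (f := α.toMonoidHom) α.continuous α.toHomeomorph.isOpenMap hKcl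
      (h.eventually_iterate_mem (hKo.mem_nhds K.one_mem)),
    hKc.of_isClosed_subset hcl stableCore_le,
    (SetLike.coe_subset_coe.mpr stableCore_le).trans hKU, fun _ => map_mem_stableCore⟩

theorem exists_iterate_mem_of_isCompact (h : IsTDLCContractionGroup G α) {C U : Set G}
    (hC : IsCompact C) (hU : U ∈ 𝓝 1) : ∃ n : ℕ, ∀ x ∈ C, α^[n] x ∈ U := by
  obtain ⟨V, hVo, -, hVU, hVα⟩ := h.exists_isOpen_isCompact_map_mem hU
  have monotone_preimage : Monotone fun n : ℕ => (⇑α)^[n] ⁻¹' (V : Set G) :=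
    monotone_nat_of_le_succ fun n x hx => by
      rw [Set.mem_preimage, Function.iterate_succ_apply']
      exact hVα _ hx
  obtain ⟨n, hn⟩ := hC.elim_directed_cover _ (fun n => hVo.preimage (α.continuous.iterate n))
    (fun x _ => Set.mem_iUnion.mpr (h.eventually_iterate_mem (hVo.mem_nhds V.one_mem) x).exists)
    monotone_preimage.directed_le
  exact ⟨n, fun x hx => hVU (hn hx)⟩

end IsTDLCContractionGroup

/-- A compact open subgroup `V` which is contracted to `0` by the powers of the automorphism `a`,
and whose translates under the negative powers of `a` exhaust the group. -/
structure IsContractingLattice {M : Type*} [AddCommGroup M] [TopologicalSpace M]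
    (a : M ≃L[ℤ] M) (V : AddSubgroup M) : Prop where
  isOpen : IsOpen (V : Set M)
  isCompact : IsCompact (V : Set M)
  map_mem : ∀ x ∈ V, a x ∈ V
  exists_pow_mem : ∀ x, ∃ n : ℕ, (a ^ n) x ∈ V
  exists_pow_subset : ∀ U ∈ 𝓝 (0 : M), ∃ n : ℕ, ∀ x ∈ V, (a ^ n) x ∈ U

/-- An automorphism of a commutative topological group in additive notation. -/
def additiveAut {G : Type u} [CommGroup G] [TopologicalSpace G] (α : G ≃ₜ* G) :
    Additive G ≃L[ℤ] Additive G :=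
  { (MulEquiv.toAdditive α.toMulEquiv).toIntLinearEquiv with
    continuous_toFun := α.continuous
    continuous_invFun := α.symm.continuous }

theorem additiveAut_pow_apply {G : Type u} [CommGroup G] [TopologicalSpace G] (α : G ≃ₜ* G)
    (n : ℕ) (x : G) : (additiveAut α ^ n) (.ofMul x) = .ofMul (α^[n] x) := by
  induction n generalizing x with
  | zero => rfl
  | succ _ ih => exact ih (α x)

theorem IsTDLCContractionGroup.exists_isContractingLattice {G : Type u} [CommGroup G]
    [TopologicalSpace G] {α : G ≃ₜ* G} (h : IsTDLCContractionGroup G α) :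
    ∃ V, IsContractingLattice (additiveAut α) V := by
  obtain ⟨V, hVo, hVc, -, hVα⟩ := h.exists_isOpen_isCompact_map_mem univ_mem
  refine ⟨Subgroup.toAddSubgroup V, hVo, hVc, hVα, fun x => ?_, fun U hU => ?_⟩
  · obtain ⟨n, hn⟩ := (h.eventually_iterate_mem (hVo.mem_nhds V.one_mem) x.toMul).exists
    exact ⟨n, (additiveAut_pow_apply α n x.toMul).symm ▸ hn⟩
  · obtain ⟨n, hn⟩ := h.exists_iterate_mem_of_isCompact hVc hU
    exact ⟨n, fun x hx => (additiveAut_pow_apply α n x.toMul).symm ▸ hn x.toMul hx⟩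

section LaurentSeries

open PowerSeries LaurentSeries

variable {Γ : Type*} {R : Type u} [AddCommMonoid Γ] [LinearOrder Γ] [IsOrderedCancelAddMonoid Γ]
  [CommRing R]

theorem hahnSeriesC_dvd_iff {r : R} {f : HahnSeries Γ R} :
    HahnSeries.C r ∣ f ↔ ∀ n, r ∣ f.coeff n := by
  constructor
  · rintro ⟨g, rfl⟩ n
    exact ⟨g.coeff n, by rw [HahnSeries.C_apply, HahnSeries.coeff_single_zero_mul]⟩
  · intro h
    choose g hg using h
    classical
    let g' (n : Γ) : R := if f.coeff n = 0 then 0 else g n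
    have support_subset : g'.support ⊆ f.support := fun n hn h0 => hn (if_pos h0)
    refine ⟨⟨g', f.isPWO_support.mono support_subset⟩, ?_⟩
    ext n
    rw [HahnSeries.C_apply, HahnSeries.coeff_single_zero_mul]
    by_cases h0 : f.coeff n = 0
    · simp [g', h0]
    · simp [g', h0, ← hg]

theorem hahnSeriesC_dvd_iff_map_mk_eq_zero {r : R} {f : HahnSeries Γ R} :
    HahnSeries.C r ∣ f ↔ f.map (Ideal.Quotient.mk (Ideal.span {r})) = 0 := by
  rw [hahnSeriesC_dvd_iff, HahnSeries.ext_iff, funext_iff]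
  exact forall_congr' fun n => (Ideal.Quotient.eq_zero_iff_dvd r _).symm

theorem prime_hahnSeriesC {r : R} (hr : Prime r) : Prime (HahnSeries.C r : HahnSeries Γ R) := by
  have : (Ideal.span {r}).IsPrime := (Ideal.span_singleton_prime hr.ne_zero).mpr hr
  refine ⟨HahnSeries.C_ne_zero hr.ne_zero, fun hu => hr.not_isUnit ?_, fun f g h => ?_⟩
  · simpa [isUnit_iff_dvd_one] using hahnSeriesC_dvd_iff.mp (isUnit_iff_dvd_one.mp hu) 0
  · have map_mul : (f * g).map (Ideal.Quotient.mk (Ideal.span {r})) =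
        f.map (Ideal.Quotient.mk (Ideal.span {r})) * g.map (Ideal.Quotient.mk (Ideal.span {r})) :=
      HahnSeries.map_mul (Ideal.Quotient.mk (Ideal.span {r})).toNonUnitalRingHom
    rw [hahnSeriesC_dvd_iff_map_mk_eq_zero, map_mul, mul_eq_zero] at h
    rwa [hahnSeriesC_dvd_iff_map_mk_eq_zero, hahnSeriesC_dvd_iff_map_mk_eq_zero]

theorem exists_associated_hahnSeriesC [IsDomain R] [UniqueFactorizationMonoid R] {r : R}
    (hr : r ≠ 0) {f : HahnSeries Γ R} (hf : f ∣ HahnSeries.C r) :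
    ∃ q : R, q ≠ 0 ∧ Associated f (HahnSeries.C q) := by
  induction r using UniqueFactorizationMonoid.induction_on_prime generalizing f with
  | h₁ => exact absurd rfl hr
  | h₂ u hu =>
    refine ⟨1, one_ne_zero, ?_⟩
    rw [map_one, associated_one_iff_isUnit]
    exact isUnit_of_dvd_unit hf (hu.map HahnSeries.C)
  | h₃ a p ha hp ih =>
    have hC : Prime (HahnSeries.C p : HahnSeries Γ R) := prime_hahnSeriesC hp
    obtain ⟨g, hg⟩ := hf
    rw [map_mul] at hg
    rcases hC.dvd_or_dvd ⟨_, hg.symm⟩ with ⟨f', rfl⟩ | ⟨g', rfl⟩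
    · rw [mul_assoc] at hg
      obtain ⟨q, hq, hfq⟩ := ih ha ⟨g, mul_left_cancel₀ hC.ne_zero hg⟩
      exact ⟨p * q, mul_ne_zero hp.ne_zero hq, by rw [map_mul]; exact hfq.mul_left _⟩
    · rw [mul_left_comm] at hg
      exact ih ha ⟨g', mul_left_cancel₀ hC.ne_zero hg⟩

theorem hasSum_coeff_mul_coeff_sub_smul {M : Type*} [AddCommGroup M] [Module R M]
    [TopologicalSpace M] (f g : R⸨X⸩) (n : ℤ) (y : M) :
    HasSum (fun i => (f.coeff i * g.coeff (n - i)) • y) ((f * g).coeff n • y) := by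
  let s := Finset.antidiagonal f.isPWO_support g.isPWO_support n
  have eq_sub (p : s) : p.1.2 = n - p.1.1 :=
    eq_sub_of_add_eq' (Finset.mem_antidiagonal.mp p.2).2.2
  have injective_fst : Function.Injective fun p : s => p.1.1 := fun p q hpq =>
    Subtype.ext (Prod.ext hpq (by rw [eq_sub, eq_sub]; exact congrArg _ hpq))
  rw [HahnSeries.coeff_mul, Finset.sum_smul, ← injective_fst.hasSum_iff]
  · refine (s.hasSum fun p => (f.coeff p.1 * g.coeff p.2) • y).congr_fun fun p => ?_
    simp only [Function.comp_apply, eq_sub]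
  · intro i hi
    by_contra hne
    refine hi ⟨⟨(i, n - i), Finset.mem_antidiagonal.mpr ⟨?_, ?_, add_sub_cancel _ _⟩⟩, rfl⟩
    · exact fun h0 => hne (by rw [h0, zero_mul, zero_smul])
    · exact fun h0 => hne (by rw [h0, mul_zero, zero_smul])

variable (R) in
/-- A prime ideal `P` of `R⸨X⸩` is generated by its contraction to `R⟦X⟧`, which does not contain
`X`. By the Kaplansky-type criterion `exist_eq_span_eq_ncard_of_X_notMem` the contraction needs
no more generators than the ideal of its constant coefficients. -/
theorem isPrincipalIdealRing_laurentSeries [IsPrincipalIdealRing R] :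
    IsPrincipalIdealRing R⸨X⸩ := by
  refine IsPrincipalIdealRing.of_prime fun P hP => ?_
  have := LaurentSeries.of_powerSeries_localization (R := R)
  have hX : X ∉ P.under R⟦X⟧ := fun hX => hP.ne_top <|
    P.eq_top_of_isUnit_mem hX <|
      IsLocalization.map_units R⸨X⸩ (⟨X, Submonoid.mem_powers X⟩ : Submonoid.powers (X : R⟦X⟧))
  obtain ⟨a, ha⟩ := (IsPrincipalIdealRing.principal ((P.under R⟦X⟧).map constantCoeff)).principal
  have : (P.under R⟦X⟧).IsPrime := hP.comap _
  obtain ⟨T, hT, -, hcard⟩ := exist_eq_span_eq_ncard_of_X_notMem hX (S := {a}) ha.symm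
    (Set.finite_singleton a)
  obtain ⟨t, rfl⟩ := Set.ncard_eq_one.mp (hcard.trans (Set.ncard_singleton a))
  refine ⟨⟨algebraMap R⟦X⟧ R⸨X⸩ t, ?_⟩⟩
  rw [← IsLocalization.map_under (Submonoid.powers (X : R⟦X⟧)) R⸨X⸩ P, hT, Ideal.map_span,
    Set.image_singleton]

theorem exists_presentation_of_torsion [IsDomain R] [IsPrincipalIdealRing R] {M : Type*}
    [AddCommGroup M] [Module R⸨X⸩ M] [Module.Finite R⸨X⸩ M]
    (htors : ∀ x : M, ∃ r : R, r ≠ 0 ∧ (HahnSeries.C r : R⸨X⸩) • x = 0) :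
    ∃ (ι : Type u) (_ : Fintype ι) (q : ι → R) (π : (ι → R⸨X⸩) →ₗ[R⸨X⸩] M), (∀ i, q i ≠ 0) ∧
      Function.Surjective π ∧ ∀ f, π f = 0 ↔ ∀ i, HahnSeries.C (q i) ∣ f i := by
  classical
  have := isPrincipalIdealRing_laurentSeries R
  have isTorsion : Module.IsTorsion R⸨X⸩ M := fun {x} => by
    obtain ⟨r, hr, hx⟩ := htors x
    exact ⟨⟨HahnSeries.C r, mem_nonZeroDivisors_of_ne_zero (HahnSeries.C_ne_zero hr)⟩, hx⟩
  obtain ⟨ι, _, p, -, e, ⟨φ⟩⟩ := Module.equiv_directSum_of_isTorsion isTorsion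
  let ψ := (φ.trans (DirectSum.linearEquivFunOnFintype R⸨X⸩ ι _)).symm
  let π : (ι → R⸨X⸩) →ₗ[R⸨X⸩] M :=
    ψ.toLinearMap ∘ₗ LinearMap.piMap fun i => (Ideal.span {p i ^ e i}).mkQ
  have map_eq_zero_iff (f : ι → R⸨X⸩) : π f = 0 ↔ ∀ i, p i ^ e i ∣ f i := by
    simp [π, funext_iff, Ideal.Quotient.eq_zero_iff_dvd]
  have exists_associated (i : ι) : ∃ q : R, q ≠ 0 ∧ Associated (p i ^ e i) (HahnSeries.C q) := by
    obtain ⟨r, hr, hx⟩ := htors (π (Pi.single i 1))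
    rw [← map_smul, ← Pi.single_smul, smul_eq_mul, mul_one, map_eq_zero_iff] at hx
    exact exists_associated_hahnSeriesC hr (by simpa using hx i)
  choose q hq hpq using exists_associated
  refine ⟨ι, inferInstance, q, π, hq, ?_, fun f => ?_⟩
  · exact ψ.surjective.comp (Function.Surjective.piMap fun i => Submodule.mkQ_surjective _)
  · simp_rw [map_eq_zero_iff, (hpq _).dvd_iff_dvd_left]

end LaurentSeries

namespace IsContractingLattice

variable {M : Type*} [AddCommGroup M] [TopologicalSpace M] {a : M ≃L[ℤ] M} {V : AddSubgroup M}

theorem zpow_apply_zpow_apply (m n : ℤ) (x : M) : (a ^ m) ((a ^ n) x) = (a ^ (m + n)) x := by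
  rw [zpow_add]
  rfl

theorem zpow_zero_apply (x : M) : (a ^ (0 : ℤ)) x = x := by
  rw [zpow_zero]
  rfl

section Filtration

/-- The filtration of the group by the images `a ^ n (V)` of the lattice. -/
def filtration (a : M ≃L[ℤ] M) (V : AddSubgroup M) (n : ℤ) : AddSubgroup M :=
  V.comap (a ^ (-n)).toLinearEquiv.toAddMonoidHom

theorem mem_filtration {n : ℤ} {x : M} : x ∈ filtration a V n ↔ (a ^ (-n)) x ∈ V := Iff.rfl

theorem zpow_mem_filtration {n k : ℤ} {x : M} :
    (a ^ k) x ∈ filtration a V n ↔ x ∈ filtration a V (n - k) := by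
  rw [mem_filtration, mem_filtration, zpow_apply_zpow_apply, neg_sub, neg_add_eq_sub]

theorem pow_mem_filtration {n : ℕ} {x : M} (hx : x ∈ V) : (a ^ n) x ∈ filtration a V n := by
  rwa [← zpow_natCast, zpow_mem_filtration, sub_self, mem_filtration, neg_zero, zpow_zero_apply]

theorem antitone_filtration (hV : IsContractingLattice a V) : Antitone (filtration a V) :=
  antitone_int_of_succ_le fun n x hx => by
    have apply_eq : a ((a ^ (-(n + 1))) x) = (a ^ (-n)) x := by
      have := zpow_apply_zpow_apply (a := a) 1 (-(n + 1)) x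
      rwa [zpow_one, neg_add_rev, add_neg_cancel_left, ← neg_add_rev] at this
    exact mem_filtration.mpr (apply_eq ▸ hV.map_mem _ hx)

theorem isOpen_filtration (hV : IsContractingLattice a V) (n : ℤ) :
    IsOpen (filtration a V n : Set M) :=
  hV.isOpen.preimage (a ^ (-n)).continuous

theorem exists_mem_filtration (hV : IsContractingLattice a V) (x : M) :
    ∃ n : ℤ, x ∈ filtration a V n := by
  obtain ⟨n, hn⟩ := hV.exists_pow_mem x
  exact ⟨-n, by simpa [mem_filtration] using hn⟩

theorem exists_forall_mem_filtration (hV : IsContractingLattice a V) {ι : Type*} [Finite ι]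
    (x : ι → M) : ∃ n : ℤ, ∀ i, x i ∈ filtration a V n := by
  choose n hn using fun i => hV.exists_mem_filtration (x i)
  obtain ⟨N, hN⟩ := (Set.finite_range n).bddBelow
  exact ⟨N, fun i => hV.antitone_filtration (hN ⟨i, rfl⟩) (hn i)⟩

theorem exists_filtration_subset (hV : IsContractingLattice a V) {U : Set M} (hU : U ∈ 𝓝 0) :
    ∃ n : ℤ, (filtration a V n : Set M) ⊆ U := by
  obtain ⟨n, hn⟩ := hV.exists_pow_subset U hU
  refine ⟨n, fun x hx => ?_⟩
  have : (a ^ n) ((a ^ (-n : ℤ)) x) ∈ U := hn _ hx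
  rwa [← zpow_natCast, zpow_apply_zpow_apply, add_neg_cancel, zpow_zero_apply] at this

theorem tendsto_pow_apply (hV : IsContractingLattice a V) {r : ℕ → M} (hr : ∀ n, r n ∈ V) :
    Tendsto (fun n : ℕ => (a ^ n) (r n)) atTop (𝓝 0) := fun U hU => by
  obtain ⟨N, hN⟩ := hV.exists_filtration_subset hU
  exact mem_atTop_sets.mpr ⟨N.toNat, fun n hn =>
    hN (hV.antitone_filtration (Int.toNat_le.mp hn) (pow_mem_filtration (hr n)))⟩

end Filtration

section Summable

variable [IsTopologicalAddGroup M]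

theorem nonarchimedeanAddGroup (hV : IsContractingLattice a V) : NonarchimedeanAddGroup M where
  is_nonarchimedean U hU := by
    obtain ⟨n, hn⟩ := hV.exists_filtration_subset hU
    exact ⟨⟨filtration a V n, hV.isOpen_filtration n⟩, hn⟩

theorem tsum_mem_filtration (hV : IsContractingLattice a V) {ι : Type*} {n : ℤ} {g : ι → M}
    (hg : ∀ i, g i ∈ filtration a V n) : ∑' i, g i ∈ filtration a V n := by
  by_cases h : Summable g
  · exact (AddSubgroup.isClosed_of_isOpen _ (hV.isOpen_filtration n)).mem_of_tendsto h.hasSum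
      (.of_forall fun s => sum_mem fun i _ => hg i)
  · rw [tsum_eq_zero_of_not_summable h]
    exact zero_mem _

variable [LocallyCompactSpace M]

theorem summable_of_mem_filtration (hV : IsContractingLattice a V) {ι : Type*} {g : ι → M}
    {d : ι → ℤ} (hd : ∀ i, g i ∈ filtration a V (d i))
    (hfin : ∀ N : ℤ, {i | d i < N ∧ g i ≠ 0}.Finite) : Summable g := by
  let _ : UniformSpace M := IsTopologicalAddGroup.rightUniformSpace M
  have : IsUniformAddGroup M := isUniformAddGroup_of_addCommGroup
  have : CompleteSpace M := IsRightUniformAddGroup.completeSpace_of_weaklyLocallyCompactSpace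
  have := hV.nonarchimedeanAddGroup
  refine NonarchimedeanAddGroup.summable_of_tendsto_cofinite_zero fun U hU => ?_
  obtain ⟨N, hN⟩ := hV.exists_filtration_subset hU
  refine (hfin N).subset fun i hi => ⟨?_, fun h0 => hi ?_⟩
  · by_contra! h
    exact hi (hN (hV.antitone_filtration h (hd i)))
  · rw [Set.mem_preimage, h0]
    exact mem_of_mem_nhds hU

theorem summable_zpow_apply (hV : IsContractingLattice a V) {y : ℤ → M} {N k : ℤ}
    (hy : ∀ n < N, y n = 0) (hk : ∀ n, y n ∈ filtration a V k) :
    Summable fun n : ℤ => (a ^ n) (y n) := by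
  refine hV.summable_of_mem_filtration (d := fun n => k + n)
    (fun n => zpow_mem_filtration.mpr (by simpa using hk n)) fun K => ?_
  refine (Set.finite_Ico N (K - k)).subset fun n hn => ⟨?_, by linarith [hn.1]⟩
  by_contra! h
  exact hn.2 (by rw [hy n h, map_zero])

theorem summable_pow_apply (hV : IsContractingLattice a V) {y : ℕ → M} (hy : ∀ n, y n ∈ V) :
    Summable fun n : ℕ => (a ^ n) (y n) :=
  hV.summable_of_mem_filtration (d := (↑)) (fun n => pow_mem_filtration (hy n)) fun K =>
    (Set.finite_Iio K.toNat).subset fun n hn => by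
      have := hn.1
      simp only [Set.mem_Iio]
      omega

end Summable

section LaurentModule

open PowerSeries LaurentSeries

/-- The action of an integral Laurent series on the group, the variable acting as the automorphism
`a`. The series converges if there is a contracting lattice; in general its value may be junk. -/
noncomputable def laurentSMul (a : M ≃L[ℤ] M) (f : ℤ⸨X⸩) (x : M) : M :=
  ∑' n : ℤ, f.coeff n • (a ^ n) x

theorem laurentSMul_single (n c : ℤ) (x : M) :
    laurentSMul a (HahnSeries.single n c) x = c • (a ^ n) x := by
  rw [laurentSMul, tsum_eq_single n fun k hk => by
    rw [HahnSeries.coeff_single_of_ne hk, zero_smul], HahnSeries.coeff_single_same]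

theorem laurentSMul_ofPowerSeries (f : ℤ⟦X⟧) (x : M) :
    laurentSMul a (HahnSeries.ofPowerSeries ℤ ℤ f) x = ∑' n : ℕ, coeff n f • (a ^ n) x := by
  rw [laurentSMul, ← (Nat.cast_injective (R := ℤ)).tsum_eq]
  · simp
  · intro n hn
    by_contra hneg
    refine hn ?_
    have : n < 0 := by
      by_contra! h
      exact hneg ⟨n.toNat, Int.toNat_of_nonneg h⟩
    simp [PowerSeries.coeff_coe, this]

variable [IsTopologicalAddGroup M] [LocallyCompactSpace M]

theorem summable_coeff_smul (hV : IsContractingLattice a V) (f : ℤ⸨X⸩) (x : M) :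
    Summable fun n : ℤ => f.coeff n • (a ^ n) x := by
  obtain ⟨k, hk⟩ := hV.exists_mem_filtration x
  simp_rw [← map_zsmul]
  refine hV.summable_zpow_apply (N := f.order) (k := k) (fun n hn => ?_) fun n => zsmul_mem hk _
  rw [HahnSeries.coeff_eq_zero_of_lt_order hn, zero_smul]

theorem summable_coeff_mul_coeff_smul (hV : IsContractingLattice a V) (f g : ℤ⸨X⸩) (x : M) :
    Summable fun p : ℤ × ℤ => (f.coeff p.1 * g.coeff p.2) • (a ^ (p.1 + p.2)) x := by
  obtain ⟨k, hk⟩ := hV.exists_mem_filtration x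
  refine hV.summable_of_mem_filtration (d := fun p => k + (p.1 + p.2))
    (fun p => zsmul_mem (zpow_mem_filtration.mpr (by simpa using hk)) _) fun K => ?_
  refine ((Set.finite_Ico f.order (K - k - g.order)).prod
    (Set.finite_Ico g.order (K - k - f.order))).subset ?_
  rintro ⟨i, j⟩ ⟨hlt, hne⟩
  have hi : f.order ≤ i := by
    by_contra! hi
    exact hne (by simp [HahnSeries.coeff_eq_zero_of_lt_order hi])
  have hj : g.order ≤ j := by
    by_contra! hj
    exact hne (by simp [HahnSeries.coeff_eq_zero_of_lt_order hj])
  simp only [Set.mem_prod, Set.mem_Ico]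
  simp only at hlt
  omega

variable [T2Space M]

theorem laurentSMul_laurentSMul (hV : IsContractingLattice a V) (f g : ℤ⸨X⸩) (x : M) :
    laurentSMul a f (laurentSMul a g x) =
      ∑' p : ℤ × ℤ, (f.coeff p.1 * g.coeff p.2) • (a ^ (p.1 + p.2)) x := by
  have hasSum_row (i : ℤ) : HasSum (fun j => (f.coeff i * g.coeff j) • (a ^ (i + j)) x)
      (f.coeff i • (a ^ i) (laurentSMul a g x)) := by
    refine (((hV.summable_coeff_smul g x).hasSum.map (a ^ i) (a ^ i).continuous).const_smul
      (f.coeff i)).congr_fun fun j => ?_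
    rw [Function.comp_apply, map_zsmul, zpow_apply_zpow_apply, smul_smul]
  rw [(hV.summable_coeff_mul_coeff_smul f g x).tsum_prod' fun i => (hasSum_row i).summable]
  exact tsum_congr fun i => (hasSum_row i).tsum_eq.symm

theorem laurentSMul_mul (hV : IsContractingLattice a V) (f g : ℤ⸨X⸩) (x : M) :
    laurentSMul a (f * g) x = laurentSMul a f (laurentSMul a g x) := by
  let e : ℤ × ℤ ≃ ℤ × ℤ :=
    ⟨fun p => (p.2, p.1 - p.2), fun p => (p.1 + p.2, p.1), fun p => by simp, fun p => by simp⟩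
  have reindex (p : ℤ × ℤ) :
      (f.coeff (e p).1 * g.coeff (e p).2) • (a ^ ((e p).1 + (e p).2)) x =
        (f.coeff p.2 * g.coeff (p.1 - p.2)) • (a ^ p.1) x := by
    simp [e]
  have hasSum_fiber (n : ℤ) := hasSum_coeff_mul_coeff_sub_smul f g n ((a ^ n) x)
  have summable_reindexed :=
    (e.summable_iff.mpr (hV.summable_coeff_mul_coeff_smul f g x)).congr reindex
  rw [hV.laurentSMul_laurentSMul, ← e.tsum_eq, tsum_congr reindex,
    summable_reindexed.tsum_prod' fun n => (hasSum_fiber n).summable]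
  exact tsum_congr fun n => (hasSum_fiber n).tsum_eq.symm

/-- The `ℤ⸨X⸩`-module structure for which the variable acts as the automorphism `a`. -/
noncomputable abbrev laurentModule (hV : IsContractingLattice a V) : Module ℤ⸨X⸩ M where
  smul := laurentSMul a
  one_smul x := (laurentSMul_single 0 1 x).trans (by rw [one_smul, zpow_zero_apply])
  mul_smul := hV.laurentSMul_mul
  smul_zero f := by
    change laurentSMul a f 0 = 0
    simp [laurentSMul]
  smul_add f x y := by
    change laurentSMul a f (x + y) = laurentSMul a f x + laurentSMul a f y
    simp only [laurentSMul, map_add, smul_add,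
      ← (hV.summable_coeff_smul f x).tsum_add (hV.summable_coeff_smul f y)]
  add_smul f g x := by
    change laurentSMul a (f + g) x = laurentSMul a f x + laurentSMul a g x
    simp only [laurentSMul, HahnSeries.coeff_add, add_smul,
      ← (hV.summable_coeff_smul f x).tsum_add (hV.summable_coeff_smul g x)]
  zero_smul x := by
    change laurentSMul a 0 x = 0
    simp [laurentSMul]

end LaurentModule

section FiniteGeneration

theorem exists_digits_remainders {T : Finset M}
    (hT : ∀ x ∈ V, ∃ t ∈ T, x - t ∈ filtration a V 1) {x : M} (hx : x ∈ V) :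
    ∃ d r : ℕ → M, (∀ n, d n ∈ T) ∧ (∀ n, r n ∈ V) ∧
      ∀ n, ∑ i ∈ Finset.range n, (a ^ i) (d i) + (a ^ n) (r n) = x := by
  choose! t ht hxt using hT
  let r (n : ℕ) : M := Nat.rec x (fun _ y => (a ^ (-1 : ℤ)) (y - t y)) n
  have hr (n : ℕ) : r n ∈ V := by
    induction n with
    | zero => exact hx
    | succ n ih => exact hxt _ ih
  refine ⟨fun n => t (r n), r, fun n => ht _ (hr n), hr, fun n => ?_⟩
  induction n with
  | zero => rw [Finset.sum_range_zero, zero_add, pow_zero]; rfl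
  | succ n ih =>
    have pow_succ_apply : (a ^ (n + 1)) (r (n + 1)) = (a ^ n) (r n - t (r n)) := by
      change (a ^ (n + 1)) ((a ^ (-1 : ℤ)) (r n - t (r n))) = _
      rw [← zpow_natCast, zpow_apply_zpow_apply, ← zpow_natCast]
      congr 2
      push_cast
      ring
    rw [Finset.sum_range_succ, pow_succ_apply, map_sub, add_assoc, add_sub_cancel, ih]

variable [IsTopologicalAddGroup M]

theorem exists_finset_digits (hV : IsContractingLattice a V) :
    ∃ T : Finset M, (∀ t ∈ T, t ∈ V) ∧ ∀ x ∈ V, ∃ t ∈ T, x - t ∈ filtration a V 1 := by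
  classical
  obtain ⟨T, hT⟩ := hV.isCompact.elim_nhds_subcover'
    (fun x _ => {y | y - x ∈ filtration a V 1}) fun x _ =>
      ((hV.isOpen_filtration 1).preimage (continuous_id.sub continuous_const)).mem_nhds (by simp)
  refine ⟨T.image Subtype.val, fun t ht => ?_, fun x hx => ?_⟩
  · obtain ⟨s, -, rfl⟩ := Finset.mem_image.mp ht
    exact s.2
  · obtain ⟨t, ht, hxt⟩ := Set.mem_iUnion₂.mp (hT hx)
    exact ⟨t, Finset.mem_image_of_mem _ ht, hxt⟩

variable [LocallyCompactSpace M] [T2Space M]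

theorem exists_hasSum_digits (hV : IsContractingLattice a V) {T : Finset M}
    (hTV : ∀ t ∈ T, t ∈ V) (hT : ∀ x ∈ V, ∃ t ∈ T, x - t ∈ filtration a V 1) {x : M}
    (hx : x ∈ V) : ∃ d : ℕ → M, (∀ n, d n ∈ T) ∧ HasSum (fun n : ℕ => (a ^ n) (d n)) x := by
  obtain ⟨d, r, hd, hr, hx⟩ := exists_digits_remainders hT hx
  refine ⟨d, hd, (hV.summable_pow_apply fun n => hTV _ (hd n)).hasSum_iff_tendsto_nat.mpr ?_⟩
  simpa only [sub_zero, ← eq_sub_iff_add_eq.mpr (hx _)] using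
    (tendsto_const_nhds (x := x)).sub (hV.tendsto_pow_apply hr)

open PowerSeries LaurentSeries

theorem mem_span_of_hasSum_digits (hV : IsContractingLattice a V) {T : Finset M}
    (hTV : ∀ t ∈ T, t ∈ V) {d : ℕ → M} (hd : ∀ n, d n ∈ T) {x : M}
    (hx : HasSum (fun n : ℕ => (a ^ n) (d n)) x) :
    letI := hV.laurentModule
    x ∈ Submodule.span ℤ⸨X⸩ (T : Set M) := by
  classical
  let := hV.laurentModule
  let indicator (t : M) : ℤ⟦X⟧ := .mk fun n => if d n = t then 1 else 0
  suffices x = ∑ t ∈ T, HahnSeries.ofPowerSeries ℤ ℤ (indicator t) • t by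
    rw [this]
    exact sum_mem fun t ht => Submodule.smul_mem _ _ (Submodule.subset_span ht)
  have summable_indicator (t : M) (ht : t ∈ T) :
      Summable fun n : ℕ => coeff n (indicator t) • (a ^ n) t := by
    simpa only [map_zsmul] using
      hV.summable_pow_apply fun n => zsmul_mem (hTV t ht) (coeff n (indicator t))
  calc x = ∑' n : ℕ, (a ^ n) (d n) := hx.tsum_eq.symm
    _ = ∑' n : ℕ, ∑ t ∈ T, coeff n (indicator t) • (a ^ n) t :=
        tsum_congr fun n => by simp [indicator, ite_smul, hd]
    _ = ∑ t ∈ T, ∑' n : ℕ, coeff n (indicator t) • (a ^ n) t :=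
        Summable.tsum_finsetSum summable_indicator
    _ = ∑ t ∈ T, HahnSeries.ofPowerSeries ℤ ℤ (indicator t) • t :=
        Finset.sum_congr rfl fun t _ => (laurentSMul_ofPowerSeries _ _).symm

theorem finite_laurentModule (hV : IsContractingLattice a V) :
    letI := hV.laurentModule
    Module.Finite ℤ⸨X⸩ M := by
  let := hV.laurentModule
  obtain ⟨T, hTV, hT⟩ := hV.exists_finset_digits
  refine ⟨⟨T, eq_top_iff.mpr fun x _ => ?_⟩⟩
  obtain ⟨n, hn⟩ := hV.exists_pow_mem x
  obtain ⟨d, hd, hsum⟩ := hV.exists_hasSum_digits hTV hT hn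
  have single_smul : (HahnSeries.single (-n : ℤ) 1 : ℤ⸨X⸩) • (a ^ n) x = x := by
    refine (laurentSMul_single (-n : ℤ) 1 ((a ^ n) x)).trans ?_
    rw [one_smul, ← zpow_natCast, zpow_apply_zpow_apply, neg_add_cancel, zpow_zero_apply]
  rw [← single_smul]
  exact Submodule.smul_mem _ _ (hV.mem_span_of_hasSum_digits hTV hd hsum)

end FiniteGeneration

end IsContractingLattice

section LaurentDigits

open LaurentSeries ShiftGroup

variable {R : Type u} [CommRing R]

theorem exists_linearMap_pi_quotient_span {M ι : Type*} [AddCommGroup M] [Module R M] [Fintype ι]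
    {q : ι → R} {b : ι → M} (h : ∀ i, q i • b i = 0) :
    ∃ θ : (∀ i, R ⧸ Ideal.span {q i}) →ₗ[R] M,
      ∀ c : ι → R, θ (fun i => Ideal.Quotient.mk _ (c i)) = ∑ i, c i • b i := by
  classical
  let lift (i : ι) : (R ⧸ Ideal.span {q i}) →ₗ[R] M :=
    Submodule.liftQ _ (LinearMap.toSpanSingleton R M (b i)) <| by
      rw [Ideal.span, Submodule.span_singleton_le_iff_mem]
      exact h i
  exact ⟨LinearMap.lsum R _ R lift, fun c => by
    rw [LinearMap.lsum_apply, LinearMap.sum_apply]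
    rfl⟩

variable {ι : Type*} [Finite ι] (q : ι → R)

/-- The coefficients of a tuple of Laurent series, reduced modulo the `q i`. This realises the
isomorphism between the product of the `R⸨X⸩ ⧸ (q i)` and a shift group. -/
def coeffMod (f : ι → R⸨X⸩) : ShiftGroup (Multiplicative (∀ i, R ⧸ Ideal.span {q i})) :=
  ofEntries (fun n => .ofAdd fun i => Ideal.Quotient.mk _ ((f i).coeff n)) <| by
    obtain ⟨N, hN⟩ := (Set.finite_range fun i => (f i).order).bddBelow
    refine ⟨N, fun n hn => congrArg Multiplicative.ofAdd (funext fun i => ?_)⟩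
    rw [HahnSeries.coeff_eq_zero_of_lt_order (hn.trans_le (hN ⟨i, rfl⟩)), map_zero]
    rfl

theorem entry_coeffMod (f : ι → R⸨X⸩) (n : ℤ) :
    (coeffMod q f).entry n = .ofAdd fun i => Ideal.Quotient.mk _ ((f i).coeff n) :=
  entry_ofEntries _ _ n

theorem coeffMod_eq_one_iff {f : ι → R⸨X⸩} :
    coeffMod q f = 1 ↔ ∀ i, HahnSeries.C (q i) ∣ f i := by
  simp_rw [hahnSeriesC_dvd_iff, ← Ideal.Quotient.eq_zero_iff_dvd]
  constructor
  · intro h i n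
    have hn := entry_coeffMod q f n
    rw [h, entry_one] at hn
    exact (congrFun hn i).symm
  · exact fun h => ext_entry fun n => by
      rw [entry_coeffMod, entry_one]
      exact funext fun i => h i n

theorem coeffMod_surjective : Function.Surjective (coeffMod q) := fun y => by
  obtain ⟨N, hN⟩ := y.exists_mem_tail
  choose rep hrep using fun i => Ideal.Quotient.mk_surjective (I := Ideal.span {q i})
  let f (i : ι) : R⸨X⸩ :=
    .ofSuppBddBelow (fun n => if n < N then 0 else rep i ((y.entry n).toAdd i))
      ⟨N, fun n hn => by
        by_contra! h
        exact hn (if_pos h)⟩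
  refine ⟨f, ext_entry fun n => ?_⟩
  rw [entry_coeffMod]
  refine Multiplicative.toAdd.injective (funext fun i => ?_)
  change Ideal.Quotient.mk _ (if n < N then 0 else rep i ((y.entry n).toAdd i)) =
    (y.entry n).toAdd i
  rcases lt_or_ge n N with hn | hn
  · rw [if_pos hn, mem_tail.mp hN n hn, map_zero]
    rfl
  · rw [if_neg hn.not_gt, hrep]

end LaurentDigits

namespace IsContractingLattice

open LaurentSeries ShiftGroup

variable {M : Type*} [AddCommGroup M] [TopologicalSpace M] [IsTopologicalAddGroup M]
  [LocallyCompactSpace M] {a : M ≃L[ℤ] M} {V : AddSubgroup M} {A : Type*} [AddCommGroup A]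
  [Finite A]

theorem summable_zpow_entry (hV : IsContractingLattice a V) (θ : A →+ M)
    (y : ShiftGroup (Multiplicative A)) :
    Summable fun n : ℤ => (a ^ n) (θ (y.entry n).toAdd) := by
  obtain ⟨k, hk⟩ := hV.exists_forall_mem_filtration θ
  obtain ⟨N, hN⟩ := y.exists_mem_tail
  refine hV.summable_zpow_apply (N := N) (fun n hn => ?_) fun n => hk _
  rw [mem_tail.mp hN n hn, toAdd_one, map_zero]

variable [T2Space M]

/-- The homomorphism `(x_n)_n ↦ ∑ n, a ^ n (θ x_n)` from a shift group. -/
noncomputable def sumHom (hV : IsContractingLattice a V) (θ : A →+ M) :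
    ShiftGroup (Multiplicative A) →* Multiplicative M where
  toFun y := .ofAdd (∑' n : ℤ, (a ^ n) (θ (y.entry n).toAdd))
  map_one' := by simp [entry_one]
  map_mul' x y := by
    simp only [entry_mul, toAdd_mul, map_add, ← ofAdd_add,
      ← (hV.summable_zpow_entry θ x).tsum_add (hV.summable_zpow_entry θ y)]

theorem toAdd_sumHom (hV : IsContractingLattice a V) (θ : A →+ M)
    (y : ShiftGroup (Multiplicative A)) :
    (hV.sumHom θ y).toAdd = ∑' n : ℤ, (a ^ n) (θ (y.entry n).toAdd) := rfl

theorem toAdd_sumHom_shift (hV : IsContractingLattice a V) (θ : A →+ M)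
    (y : ShiftGroup (Multiplicative A)) :
    (hV.sumHom θ (shift _ y)).toAdd = a (hV.sumHom θ y).toAdd := by
  have hasSum_apply := (hV.summable_zpow_entry θ y).hasSum.map a a.continuous
  rw [toAdd_sumHom, toAdd_sumHom, ← hasSum_apply.tsum_eq, ← (Equiv.addRight (1 : ℤ)).tsum_eq]
  refine tsum_congr fun n => ?_
  rw [entry_shift, Equiv.coe_addRight, add_sub_cancel_right]
  change (a ^ (n + 1)) _ = _
  rw [add_comm, zpow_one_add]
  rfl

theorem continuous_sumHom (hV : IsContractingLattice a V) (θ : A →+ M) :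
    Continuous (hV.sumHom θ) := by
  refine continuous_of_continuousAt_one _ fun U hU => ?_
  rw [map_one] at hU
  obtain ⟨N, hN⟩ := hV.exists_filtration_subset (U := Multiplicative.ofAdd ⁻¹' U) hU
  obtain ⟨k, hk⟩ := hV.exists_forall_mem_filtration θ
  refine mem_map.mpr <| mem_of_superset (tail_mem_nhds_one (N - k)) fun y hy =>
    hN (?_ : (hV.sumHom θ y).toAdd ∈ filtration a V N)
  refine hV.tsum_mem_filtration fun n => ?_
  rcases lt_or_ge n (N - k) with hn | hn
  · rw [mem_tail.mp hy n hn, toAdd_one, map_zero, map_zero]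
    exact zero_mem _
  · exact zpow_mem_filtration.mpr (hV.antitone_filtration (by omega) (hk _))

theorem isOpenMap_sumHom (hV : IsContractingLattice a V) {θ : A →+ M}
    (hsurj : Function.Surjective (hV.sumHom θ)) : IsOpenMap (hV.sumHom θ) := by
  have : BaireSpace (Multiplicative M) := inferInstanceAs (BaireSpace M)
  have : T2Space (Multiplicative M) := inferInstanceAs (T2Space M)
  exact (hV.sumHom θ).isOpenMap_of_sigmaCompact hsurj (hV.continuous_sumHom θ)

theorem toAdd_sumHom_coeffMod (hV : IsContractingLattice a V) {ι : Type*} [Fintype ι] {q : ι → ℤ}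
    [Finite (∀ i, ℤ ⧸ Ideal.span {q i})] {b : ι → M} {θ : (∀ i, ℤ ⧸ Ideal.span {q i}) →+ M}
    (hθ : ∀ c : ι → ℤ, θ (fun i => Ideal.Quotient.mk _ (c i)) = ∑ i, c i • b i)
    (f : ι → ℤ⸨X⸩) :
    (hV.sumHom θ (coeffMod q f)).toAdd = ∑ i, laurentSMul a (f i) (b i) := by
  simp only [toAdd_sumHom, laurentSMul,
    ← Summable.tsum_finsetSum fun i _ => hV.summable_coeff_smul (f i) (b i)]
  refine tsum_congr fun n => ?_
  rw [entry_coeffMod, toAdd_ofAdd, hθ, map_sum]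
  simp only [map_zsmul]

theorem exists_bijective_sumHom (hV : IsContractingLattice a V)
    (htors : ∀ x : M, ∃ m : ℤ, m ≠ 0 ∧ m • x = 0) :
    ∃ (A : Type) (_ : AddCommGroup A) (_ : Finite A) (θ : A →+ M),
      Function.Bijective (hV.sumHom θ) := by
  classical
  let := hV.laurentModule
  have := hV.finite_laurentModule
  have C_smul (m : ℤ) (x : M) : (HahnSeries.C m : ℤ⸨X⸩) • x = m • x :=
    (laurentSMul_single 0 m x).trans (by rw [zpow_zero_apply])
  obtain ⟨ι, _, q, π, hq, hsurj, hker⟩ := exists_presentation_of_torsion (R := ℤ) (M := M)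
    (by simpa only [C_smul] using htors)
  have finite_quotient (i : ι) : Finite (ℤ ⧸ Ideal.span {q i}) :=
    have : NeZero (q i).natAbs := ⟨Int.natAbs_ne_zero.mpr (hq i)⟩
    .of_equiv _ (Int.quotientSpanEquivZMod (q i)).symm.toEquiv
  let b (i : ι) : M := π fun j => if i = j then 1 else 0
  obtain ⟨θ, hθ⟩ := exists_linearMap_pi_quotient_span (q := q) (b := b) fun i => by
    rw [← C_smul, ← map_smul, hker]
    intro j
    rcases eq_or_ne i j with rfl | hij
    · simp
    · simp [hij]
  have toAdd_sumHom_coeffMod (f : ι → ℤ⸨X⸩) :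
      (hV.sumHom θ.toAddMonoidHom (coeffMod q f)).toAdd = π f :=
    (hV.toAdd_sumHom_coeffMod (b := b) hθ f).trans (π.pi_apply_eq_sum_univ f).symm
  refine ⟨∀ i, ℤ ⧸ Ideal.span {q i}, inferInstance, inferInstance, θ.toAddMonoidHom, ?_,
    fun x => ?_⟩
  · refine (injective_iff_map_eq_one _).mpr fun y hy => ?_
    obtain ⟨f, rfl⟩ := coeffMod_surjective q y
    rw [coeffMod_eq_one_iff, ← hker, ← toAdd_sumHom_coeffMod, hy, toAdd_one]
  · obtain ⟨f, hf⟩ := hsurj x.toAdd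
    exact ⟨coeffMod q f, (toAdd_sumHom_coeffMod f).trans hf⟩

end IsContractingLattice

theorem IsTDLCContractionGroup.exists_iso_shift {G : Type u} [CommGroup G] [TopologicalSpace G]
    {α : G ≃ₜ* G} (hG : IsTDLCContractionGroup G α) (htors : IsMulTorsion G) :
    ∃ (F : Type) (_ : CommGroup F), Finite F ∧ ContractionGroupIso α (ShiftGroup.shift F) := by
  have ⟨_, _, _, _, _⟩ := hG
  have : T2Space (Additive G) := inferInstanceAs (T2Space G)
  have : LocallyCompactSpace (Additive G) := inferInstanceAs (LocallyCompactSpace G)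
  obtain ⟨V, hV⟩ := hG.exists_isContractingLattice
  obtain ⟨A, _, _, θ, hθ⟩ := hV.exists_bijective_sumHom fun x => by
    obtain ⟨m, hm, hx⟩ := isOfFinOrder_iff_pow_eq_one.mp (htors x.toMul)
    exact ⟨m, mod_cast hm.ne', (natCast_zsmul x m).trans hx⟩
  let ψ : ShiftGroup (Multiplicative A) ≃* G :=
    (MulEquiv.ofBijective _ hθ).trans (MulEquiv.multiplicativeAdditive G)
  have continuous_ψ : Continuous ψ := hV.continuous_sumHom θ
  have isOpenMap_ψ : IsOpenMap ψ := hV.isOpenMap_sumHom hθ.2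
  refine ⟨Multiplicative A, inferInstance, inferInstance, ContractionGroupIso.symm
    ⟨⟨ψ, continuous_ψ, ?_⟩, hV.toAdd_sumHom_shift θ⟩⟩
  exact (ψ.toEquiv.toHomeomorphOfContinuousOpen continuous_ψ isOpenMap_ψ).symm.continuous

theorem theoremD_general :
    (∀ (G : Type u) [Group G] [TopologicalSpace G] (α : G ≃ₜ* G),
      IsTDLCContractionGroup G α → (∀ x y : G, x * y = y * x) → IsMulTorsion G →
        ∃ (F : Type) (_ : CommGroup F), Finite F ∧
          ContractionGroupIso α (ShiftGroup.shift F)) ∧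
    (∀ (G : Type u) [Group G] [TopologicalSpace G] (α : G ≃ₜ* G)
      (F : Type v) [Group F] [Finite F] (F' : Type w) [Group F'] [Finite F'],
        ContractionGroupIso α (ShiftGroup.shift F) →
        ContractionGroupIso α (ShiftGroup.shift F') →
        Nonempty (F ≃* F')) ∧
    (∀ (F : Type v) [Group F] [Finite F],
      IsTDLCContractionGroup (ShiftGroup F) (ShiftGroup.shift F) ∧
      ((∀ a b : F, a * b = b * a) → ∀ x y : ShiftGroup F, x * y = y * x) ∧
      IsMulTorsion (ShiftGroup F) ∧
      ∀ (G : Type u) [Group G] [TopologicalSpace G] (α : G ≃ₜ* G),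
        ContractionGroupIso α (ShiftGroup.shift F) →
          IsTDLCContractionGroup G α ∧
            ((∀ a b : F, a * b = b * a) → ∀ x y : G, x * y = y * x) ∧ IsMulTorsion G) := by
  refine ⟨fun G _ _ α hG hcomm htors => ?_, fun G _ _ α F _ _ F' _ _ h h' => ?_,
    fun F _ _ => ⟨ShiftGroup.isTDLCContractionGroup, ShiftGroup.mul_comm_of_mul_comm,
      ShiftGroup.isMulTorsion, fun G _ _ α h => ⟨?_, fun hF => ?_, ?_⟩⟩⟩
  · let _ : CommGroup G := { ‹Group G› with mul_comm := hcomm }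
    exact hG.exists_iso_shift htors
  · exact ShiftGroup.nonempty_mulEquiv_of_iso (h.symm.trans h')
  · exact h.isTDLCContractionGroup ShiftGroup.isTDLCContractionGroup
  · exact h.mul_comm_of_mul_comm (ShiftGroup.mul_comm_of_mul_comm hF)
  · exact h.isMulTorsion ShiftGroup.isMulTorsion

theorem theoremD :
    -- existence of a finite abelian group `F`
    (∀ (G : Type u) [Group G] [TopologicalSpace G] (α : G ≃ₜ* G),
      IsTDLCContractionGroup G α → (∀ x y : G, x * y = y * x) → IsMulTorsion G →
        ∃ (F : Type) (_ : CommGroup F), Finite F ∧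
          ContractionGroupIso α (ShiftGroup.shift F)) ∧
    -- `F` is determined up to isomorphism
    (∀ (G : Type u) [Group G] [TopologicalSpace G] (α : G ≃ₜ* G),
      IsTDLCContractionGroup G α → (∀ x y : G, x * y = y * x) → IsMulTorsion G →
        ∀ (F : Type v) [CommGroup F] [Finite F] (F' : Type w) [CommGroup F'] [Finite F'],
          ContractionGroupIso α (ShiftGroup.shift F) →
          ContractionGroupIso α (ShiftGroup.shift F') →
          Nonempty (F ≃* F')) ∧
    -- conversely, `F^(-ℕ) × F^(ℕ₀)` with the right shift, and everything isomorphic to it,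
    -- is an abelian torsion contraction group
    (∀ (F : Type v) [CommGroup F] [Finite F],
      IsTDLCContractionGroup (ShiftGroup F) (ShiftGroup.shift F) ∧
      (∀ x y : ShiftGroup F, x * y = y * x) ∧ IsMulTorsion (ShiftGroup F) ∧
      ∀ (G : Type u) [Group G] [TopologicalSpace G] (α : G ≃ₜ* G),
        ContractionGroupIso α (ShiftGroup.shift F) →
          IsTDLCContractionGroup G α ∧ (∀ x y : G, x * y = y * x) ∧ IsMulTorsion G) := by
  have ⟨existence, uniqueness, converse⟩ := theoremD_general.{u, v, w}
  exact ⟨existence, fun G _ _ α _ _ _ F _ _ F' _ _ => uniqueness G α F F', fun F _ _ => by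
    simpa only [mul_comm, implies_true, forall_const] using converse F⟩
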